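/- Let $q$ be an odd prime power and let $\mathcal Q(6,q)$ be a parabolic quadric of ${\rm PG}(6,q)$ with associated orthogonal polarity $\perp$. Let $H(q)$ be a split Cayley hexagon embedded in $\mathcal Q(6,q)$ in the standard way, that is: in suitable homogeneous coordinates $\mathcal Q(6,q)$ has equation $X_0X_4+X_1X_5+X_2X_6=X_3^2$, the points of $H(q)$ are all the points of $\mathcal Q(6,q)$, and the lines of $H(q)$ are the lines of $\mathcal Q(6,q)$ whose Grassmann coordinates $p_{ij}=x_iy_j-x_jy_i$ satisfy $$p_{12}=p_{34},\quad p_{54}=p_{32},\quad p_{20}=p_{35},\quad p_{65}=p_{30},\quad p_{01}=p_{36},\quad p_{46}=p_{31}.$$ For $r\ge 4$ even, an $m$-cover of a parabolic quadric $\mathcal Q(r,q)$ is a set $\mathcal L$ of lines contained in $\mathcal Q(r,q)$ such that every point of $\mathcal Q(r,q)$ lies on exactly $m$ lines of $\mathcal L$. Put $\theta_{n,q}=q^n+\dots+q+1$ for $n\ge 0$ and $\theta_{-1,q}=0$. An $m$-cover $\mathcal L$ of $\mathcal Q(r,q)$ is called $(r-2)$-dual of parabolic type $I$ if, for every line $\ell$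 of ${\rm PG}(r,q)$, $$|\{s\in\mathcal L: s\subseteq \ell^\perp\}|=\begin{cases}\dfrac{m\,\theta_{r-5,q}}{q+1}+q^{r-4} & \text{if } \ell\in\mathcal L,\\[2mm] \dfrac{m\,\theta_{r-5,q}}{q+1} & \text{if } \ell\notin\mathcal L \text{ and } |\ell\cap\mathcal Q(r,q)|\in\{0,2,q+1\}.\end{cases}$$ Then the set of lines of $H(q)$ is a $4$-dual $(q+1)$-cover of parabolic type $I$ of $\mathcal Q(6,q)$ (here $r=6$). Explicitly: every point of $\mathcal Q(6,q)$ lies on exactly $q+1$ lines of $H(q)$; if $\ell$ is a line of $H(q)$, then $\ell^\perp$ contains exactly $q^2+q+1$ lines of $H(q)$; and if $\ell$ is any other line of ${\rm PG}(6,q)$ with $|\ell\cap\mathcal Q(6,q)|\in\{0,2,q+1\}$, then $\ell^\perp$ contains exactly $q+1$ lines of $H(q)$. -/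

import Mathlib

/-- `θ_{n,q} = q^n + ⋯ + q + 1`, the number of points of `PG(n,q)`, for an integer `n ≥ -1`;
`θ_{-1,q} = 0`. -/
def projTheta (n : ℤ) (q : ℕ) : ℕ := ∑ i ∈ Finset.range (n + 1).toNat, q ^ i

/-- The subspace `W` is totally singular, i.e. the corresponding projective subspace is contained
in the quadric `Q = 0`. -/
def IsTotallySingular {K V : Type*} [Field K] [AddCommGroup V] [Module K V]
    (Q : QuadraticForm K V) (W : Submodule K V) : Prop :=
  ∀ v ∈ W, Q v = 0

/-- The polar space `W^⊥` with respect to the orthogonal polarity of `Q`. -/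
def polarPerp {K V : Type*} [Field K] [AddCommGroup V] [Module K V]
    (Q : QuadraticForm K V) (W : Submodule K V) : Submodule K V :=
  LinearMap.BilinForm.orthogonal Q.polarBilin W

/-- The points of the projective space of `V` that lie on the quadric `Q = 0` and in the
projective subspace `W`.  Points are one-dimensional subspaces. -/
def singularPointsIn {K V : Type*} [Field K] [AddCommGroup V] [Module K V]
    (Q : QuadraticForm K V) (W : Submodule K V) : Set (Submodule K V) :=
  {P | Module.finrank K P = 1 ∧ IsTotallySingular Q P ∧ P ≤ W}

/-- `Q` defines a parabolic polar space `Q(r,q)`, `q` odd, in a projective space of even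
dimension `r ≥ 4` over the finite field `K` of order `q`. -/
structure IsParabolicPolarSpace {K V : Type*} [Field K] [AddCommGroup V] [Module K V]
    (Q : QuadraticForm K V) (r : ℕ) : Prop where
  finite : Finite K
  odd_card : Odd (Nat.card K)
  four_le : 4 ≤ r
  even : Even r
  finrank_eq : Module.finrank K V = r + 1
  nondegenerate : Q.polarBilin.Nondegenerate

/-- `L` is an `m`-cover of lines of the parabolic polar space `Q(r,q)` defined by `Q`: a set of
lines contained in the quadric such that every point of the quadric is on exactly `m` of them.
Lines are two-dimensional subspaces. -/
structure IsParabolicCover {K V : Type*} [Field K] [AddCommGroup V] [Module K V]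
    (Q : QuadraticForm K V) (r m : ℕ) (L : Set (Submodule K V)) : Prop where
  parabolic : IsParabolicPolarSpace Q r
  finrank_eq : ∀ l ∈ L, Module.finrank K l = 2
  singular : ∀ l ∈ L, IsTotallySingular Q l
  card_through : ∀ P : Submodule K V, Module.finrank K P = 1 → IsTotallySingular Q P →
    {l ∈ L | P ≤ l}.ncard = m

/-- The `m`-cover `L` of `Q(r,q)` is `(r-2)`-dual of parabolic type `I`. -/
structure IsDualCoverParabolicTypeI {K V : Type*} [Field K] [AddCommGroup V] [Module K V]
    (Q : QuadraticForm K V) (r m : ℕ) (L : Set (Submodule K V)) : Prop where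
  cover : IsParabolicCover Q r m L
  card_of_mem : ∀ l : Submodule K V, l ∈ L →
    (({s ∈ L | s ≤ polarPerp Q l}.ncard : ℕ) : ℚ) =
      (m : ℚ) * (projTheta ((r : ℤ) - 5) (Nat.card K) : ℚ) / ((Nat.card K : ℚ) + 1)
        + (Nat.card K : ℚ) ^ (r - 4)
  card_of_notMem : ∀ l : Submodule K V, Module.finrank K l = 2 → l ∉ L →
    (singularPointsIn Q l).ncard ∈ ({0, 2, Nat.card K + 1} : Set ℕ) →
    (({s ∈ L | s ≤ polarPerp Q l}.ncard : ℕ) : ℚ) =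
      (m : ℚ) * (projTheta ((r : ℤ) - 5) (Nat.card K) : ℚ) / ((Nat.card K : ℚ) + 1)

/-- The standard quadratic form `X₀X₄ + X₁X₅ + X₂X₆ - X₃²` of the quadric `Q(6,q)`. -/
def titsForm (K : Type*) [Field K] : QuadraticForm K (Fin 7 → K) :=
  QuadraticMap.proj 0 4 + QuadraticMap.proj 1 5 + QuadraticMap.proj 2 6 - QuadraticMap.proj 3 3

theorem titsForm_apply (K : Type*) [Field K] (x : Fin 7 → K) :
    titsForm K x = x 0 * x 4 + x 1 * x 5 + x 2 * x 6 - x 3 ^ 2 := by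
  simp [titsForm, sq]

/-- The Grassmann (Plücker) coordinate `p_{ij}` of the pair `x, y`. -/
def grassmannCoord {K : Type*} [Field K] (x y : Fin 7 → K) (i j : Fin 7) : K :=
  x i * y j - x j * y i

/-- The lines of the split Cayley hexagon `H(q)` in its standard embedding in `Q(6,q)`, in Tits'
coordinates: the lines of the quadric `X₀X₄ + X₁X₅ + X₂X₆ = X₃²` whose Grassmann coordinates
satisfy six linear equations.  (All pairs `x, y` of vectors of the line are used; since the
equations are bilinear and alternating, one basis of the line would be enough.) -/
def splitCayleyHexagonLines (K : Type*) [Field K] : Set (Submodule K (Fin 7 → K)) :=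
  {l | Module.finrank K l = 2 ∧ IsTotallySingular (titsForm K) l ∧
    ∀ x ∈ l, ∀ y ∈ l,
      grassmannCoord x y 1 2 = grassmannCoord x y 3 4 ∧
      grassmannCoord x y 5 4 = grassmannCoord x y 3 2 ∧
      grassmannCoord x y 2 0 = grassmannCoord x y 3 5 ∧
      grassmannCoord x y 6 5 = grassmannCoord x y 3 0 ∧
      grassmannCoord x y 0 1 = grassmannCoord x y 3 6 ∧
      grassmannCoord x y 4 6 = grassmannCoord x y 3 1}

/-- `L` is the set of lines of a split Cayley hexagon `H(q)` embedded in the quadric `Q(6,q)`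
with equation `Q = 0`: in suitable coordinates, and up to a scalar factor of the form, the quadric
and the lines are the standard ones. -/
def IsSplitCayleyHexagonIn {K V : Type*} [Field K] [AddCommGroup V] [Module K V]
    (Q : QuadraticForm K V) (L : Set (Submodule K V)) : Prop :=
  ∃ (e : V ≃ₗ[K] (Fin 7 → K)) (c : K), c ≠ 0 ∧
    (∀ v, Q v = c * titsForm K (e v)) ∧
    ∀ l : Submodule K V, l ∈ L ↔ l.map (e : V →ₗ[K] (Fin 7 → K)) ∈ splitCayleyHexagonLines K

/-!
The lines of the hexagon are the totally singular lines on which the vector product `cr` of the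
trace zero split octonions vanishes (`splitCayleyHexagonLines_eq`).  Everything is derived from
the few identities of `IsVectorProduct`, which are checked once in coordinates.

For a singular point `p` the subspace `ker (cr p)` is a totally singular plane through `p`, and the
hexagon lines on `p` are exactly the `q + 1` lines on `p` in this plane (`finrank_ker`,
`lines_through_eq`).  If `p ∈ v^⊥` and the plane of `p` is not contained in `v^⊥`, then it meets
`v^⊥` in a line, so `v^⊥` contains exactly one hexagon line on `p`.

* A totally singular line `l`: since totally singular subspaces have vector space dimension at most
  three, every other totally singular line in `l^⊥` meets `l`, so the hexagon lines in `l^⊥` can be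
  counted through the points of `l`.  If `l` is a hexagon line, each of its `q + 1` points
  contributes `q` lines besides `l`.  If not, each contributes exactly one.
* A nondegenerate line `l`: it contains a vector `w` such that `-Q w` is not a square.  The plane of
  a singular point is never contained in `w^⊥` (`isSquare_neg_of_ker_le`), so the hexagon lines in
  `w^⊥` form a spread of the quadric in this hyperplane.  The numbers of points of the quadric in
  `w^⊥` and in `l^⊥` then determine how many lines of the spread lie in `l^⊥`.  Up to a sign, the
  number of points in `w^⊥` follows from diagonalising the form, and the existence of the spread
  determines the sign.

The remaining lines of the space are tangent lines, which have exactly one point on the quadric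
(`isTotallySingular_or_disjoint_polarPerp`) and do not occur in the definition of the dual cover.
-/

/-! ### Zeros of quadratic forms over a finite field of odd order -/

section QuadricCount

variable {K : Type*} [Field K] [Fintype K] [DecidableEq K]

theorem card_filter_mul_sq_eq (hK : ringChar K ≠ 2) {a : K} (ha : a ≠ 0) (t : K) :
    (∑ x : K, if a * x ^ 2 = t then (1 : ℤ) else 0) = 1 + quadraticChar K (a * t) := by
  have h := quadraticChar_card_sqrts hK (a⁻¹ * t)
  have h1 : quadraticChar K (a * t) = quadraticChar K (a⁻¹ * t) := by
    have : a * t = a ^ 2 * (a⁻¹ * t) := by field_simp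
    rw [this, map_mul, quadraticChar_sq_one' ha, one_mul]
  rw [h1, add_comm, ← h, Finset.sum_boole]
  congr 2
  ext x
  simp only [Finset.mem_filter_univ, Set.mem_toFinset, Set.mem_ofPred_eq]
  rw [eq_inv_mul_iff_mul_eq₀ ha]

theorem sum_comp_mul_sq (hK : ringChar K ≠ 2) {a : K} (ha : a ≠ 0) (g : K → ℤ) :
    ∑ x : K, g (a * x ^ 2) = ∑ s : K, (1 + quadraticChar K (a * s)) * g s := by
  simp_rw [← card_filter_mul_sq_eq hK ha, Finset.sum_mul]
  rw [Finset.sum_comm]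
  simp

theorem sum_quadraticChar_mul (hK : ringChar K ≠ 2) (a : K) :
    ∑ s : K, quadraticChar K (a * s) = 0 := by
  simp_rw [map_mul, ← Finset.mul_sum, quadraticChar_sum_zero hK, mul_zero]

theorem sum_quadraticChar_mul_sub (hK : ringChar K ≠ 2) (v : K) :
    ∑ s : K, quadraticChar K s * quadraticChar K (v - s)
      = quadraticChar K (-1) * ((if v = 0 then (Fintype.card K : ℤ) else 0) - 1) := by
  split_ifs with hv
  · subst hv
    have h : ∀ s : K, quadraticChar K s * quadraticChar K (0 - s)
        = quadraticChar K (-1) * (1 - if s = 0 then 1 else 0) := by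
      intro s
      rw [zero_sub, neg_eq_neg_one_mul s, map_mul]
      split_ifs with hs
      · simp [hs]
      · linear_combination quadraticChar K (-1) * quadraticChar_sq_one hs
    simp_rw [h, ← Finset.mul_sum, Finset.sum_sub_distrib]
    simp
  · have h := jacobiSum_nontrivial_inv (quadraticChar_ne_one hK)
    rw [(quadraticChar_isQuadratic K).inv, jacobiSum] at h
    rw [← Equiv.sum_comp (Equiv.mulLeft₀ v hv)]
    have h2 : ∀ s : K, quadraticChar K (Equiv.mulLeft₀ v hv s) *
        quadraticChar K (v - Equiv.mulLeft₀ v hv s)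
          = quadraticChar K s * quadraticChar K (1 - s) := by
      intro s
      have : v - v * s = v * (1 - s) := by ring
      simp only [Equiv.mulLeft₀_apply, this, map_mul]
      linear_combination quadraticChar K s * quadraticChar K (1 - s) * quadraticChar_sq_one hv
    simp_rw [h2, h]
    ring

theorem sum_one_add_quadraticChar_mul (hK : ringChar K ≠ 2) (a b v : K) :
    ∑ s : K, (1 + quadraticChar K (a * s)) * (1 + quadraticChar K (b * (v - s)))
      = Fintype.card K + quadraticChar K (-(a * b)) *
          ((if v = 0 then (Fintype.card K : ℤ) else 0) - 1) := by
  have h1 := sum_quadraticChar_mul hK a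
  have h2 : ∑ s : K, quadraticChar K (b * (v - s)) = 0 := by
    rw [← sum_quadraticChar_mul hK b]
    exact Equiv.sum_comp (Equiv.subLeft v) (fun s => quadraticChar K (b * s))
  have h3 : ∑ s : K, quadraticChar K (a * s) * quadraticChar K (b * (v - s))
      = quadraticChar K (a * b) * ∑ s : K, quadraticChar K s * quadraticChar K (v - s) := by
    rw [Finset.mul_sum]
    refine Finset.sum_congr rfl fun s _ => ?_
    simp only [map_mul]
    ring
  have h4 : ∀ s : K, (1 + quadraticChar K (a * s)) * (1 + quadraticChar K (b * (v - s)))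
      = 1 + quadraticChar K (a * s) + quadraticChar K (b * (v - s))
        + quadraticChar K (a * s) * quadraticChar K (b * (v - s)) := fun s => by ring
  simp_rw [h4, Finset.sum_add_distrib, h1, h2, h3, sum_quadraticChar_mul_sub hK]
  rw [show quadraticChar K (-(a * b)) = quadraticChar K (-1) * quadraticChar K (a * b) by
    rw [← map_mul, neg_one_mul]]
  simp only [Finset.sum_const, Finset.card_univ, nsmul_eq_mul, mul_one]
  ring

/-- The number of solutions of the diagonal equation `∑ wᵢ xᵢ² = t`. -/
def diagonalCount {n : ℕ} (w : Fin n → K) (t : K) : ℤ :=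
  ∑ x : Fin n → K, if ∑ i, w i * x i ^ 2 = t then 1 else 0

theorem sum_diagonalCount_sub {n : ℕ} (w : Fin n → K) (t : K) :
    ∑ v : K, diagonalCount w (t - v) = (Fintype.card K : ℤ) ^ n := by
  unfold diagonalCount
  rw [Finset.sum_comm]
  have : ∀ (x : Fin n → K) (v : K), (∑ i, w i * x i ^ 2 = t - v) ↔ v = t - ∑ i, w i * x i ^ 2 :=
    fun x v => ⟨fun h => by rw [h]; ring, fun h => by rw [h]; ring⟩
  simp [this]

theorem diagonalCount_succ {n : ℕ} (w : Fin (n + 1) → K) (t : K) :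
    diagonalCount w t = ∑ x : K, diagonalCount (Fin.tail w) (t - w 0 * x ^ 2) := by
  unfold diagonalCount
  rw [← Equiv.sum_comp (Fin.consEquiv fun _ => K), Fintype.sum_prod_type]
  refine Finset.sum_congr rfl fun x _ => Finset.sum_congr rfl fun y _ => ?_
  simp only [Fin.sum_univ_succ, Fin.consEquiv_apply, Fin.cons_zero, Fin.cons_succ, Fin.tail,
    eq_sub_iff_add_eq']

/-- Splitting off a binary form `a x² + b y²`, which takes every nonzero value equally often. -/
theorem diagonalCount_add_two (hK : ringChar K ≠ 2) {n : ℕ} (w : Fin (n + 2) → K)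
    (hw : ∀ i, w i ≠ 0) (t : K) :
    diagonalCount w t
      = (Fintype.card K - quadraticChar K (-(w 0 * w 1))) * (Fintype.card K : ℤ) ^ n
        + quadraticChar K (-(w 0 * w 1)) * Fintype.card K
          * diagonalCount (Fin.tail (Fin.tail w)) t := by
  set g := diagonalCount (Fin.tail (Fin.tail w))
  have h1 : diagonalCount w t = ∑ s : K, ∑ u : K, (1 + quadraticChar K (w 0 * s)) *
      ((1 + quadraticChar K (w 1 * u)) * g (t - s - u)) := by
    rw [diagonalCount_succ,
      sum_comp_mul_sq hK (hw 0) (fun s => diagonalCount (Fin.tail w) (t - s))]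
    refine Finset.sum_congr rfl fun s _ => ?_
    rw [← Finset.mul_sum, diagonalCount_succ,
      ← sum_comp_mul_sq hK (hw 1) (fun u => g (t - s - u))]
    rfl
  have h2 : ∀ s : K, ∑ u : K, (1 + quadraticChar K (w 0 * s)) *
      ((1 + quadraticChar K (w 1 * u)) * g (t - s - u))
      = ∑ v : K, ((1 + quadraticChar K (w 0 * s)) * (1 + quadraticChar K (w 1 * (v - s)))) *
        g (t - v) := by
    intro s
    rw [← Equiv.sum_comp (Equiv.subRight s)]
    refine Finset.sum_congr rfl fun v _ => ?_
    rw [mul_assoc]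
    simp only [Equiv.subRight_apply]
    congr 3
    ring
  rw [h1]
  simp_rw [h2]
  rw [Finset.sum_comm]
  simp_rw [← Finset.sum_mul, sum_one_add_quadraticChar_mul hK]
  have h3 : ∀ v : K, (Fintype.card K + quadraticChar K (-(w 0 * w 1)) *
      ((if v = 0 then (Fintype.card K : ℤ) else 0) - 1)) * g (t - v)
      = (Fintype.card K - quadraticChar K (-(w 0 * w 1))) * g (t - v)
        + quadraticChar K (-(w 0 * w 1)) * Fintype.card K *
          (if v = 0 then g (t - v) else 0) := by
    intro v
    split_ifs <;> ring
  simp_rw [h3, Finset.sum_add_distrib, ← Finset.mul_sum]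
  rw [sum_diagonalCount_sub]
  simp

theorem diagonalCount_fin_zero (w : Fin 0 → K) (t : K) :
    diagonalCount w t = if t = 0 then 1 else 0 := by
  simp [diagonalCount, eq_comm]

theorem diagonalCount_one (hK : ringChar K ≠ 2) (w : Fin 1 → K) (hw : ∀ i, w i ≠ 0) :
    diagonalCount w 0 = 1 := by
  rw [diagonalCount_succ,
    sum_comp_mul_sq hK (hw 0) (fun s => diagonalCount (Fin.tail w) (0 - s))]
  simp [diagonalCount_fin_zero]

theorem diagonalCount_five (hK : ringChar K ≠ 2) (w : Fin 5 → K) (hw : ∀ i, w i ≠ 0) :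
    diagonalCount w 0 = (Fintype.card K : ℤ) ^ 4 := by
  have h1 : diagonalCount (Fin.tail (Fin.tail (Fin.tail (Fin.tail w)))) 0 = 1 :=
    diagonalCount_one hK _ fun i => hw _
  have hw2 : ∀ i, Fin.tail (Fin.tail w) i ≠ 0 := fun i => hw _
  rw [diagonalCount_add_two hK w hw, diagonalCount_add_two hK _ hw2, h1]
  ring

theorem diagonalCount_six (hK : ringChar K ≠ 2) (w : Fin 6 → K) (hw : ∀ i, w i ≠ 0) :
    ∃ ε : ℤ, (ε = 1 ∨ ε = -1) ∧ diagonalCount w 0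
      = (Fintype.card K : ℤ) ^ 5 + ε * ((Fintype.card K : ℤ) ^ 3 - (Fintype.card K : ℤ) ^ 2) := by
  have hw2 : ∀ i, Fin.tail (Fin.tail w) i ≠ 0 := fun i => hw _
  have hw4 : ∀ i, Fin.tail (Fin.tail (Fin.tail (Fin.tail w))) i ≠ 0 := fun i => hw _
  have hε : ∀ a b : K, a ≠ 0 → b ≠ 0 →
      quadraticChar K (-(a * b)) = 1 ∨ quadraticChar K (-(a * b)) = -1 :=
    fun a b ha hb => quadraticChar_dichotomy (neg_ne_zero.2 (mul_ne_zero ha hb))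
  have e1 := hε _ _ (hw 0) (hw 1)
  have e2 := hε _ _ (hw 2) (hw 3)
  have e3 := hε _ _ (hw 4) (hw 5)
  refine ⟨quadraticChar K (-(w 0 * w 1)) * quadraticChar K (-(w 2 * w 3)) *
    quadraticChar K (-(w 4 * w 5)), ?_, ?_⟩
  · rcases e1 with h | h <;> rcases e2 with h' | h' <;> rcases e3 with h'' | h'' <;>
      simp [h, h', h'']
  · rw [diagonalCount_add_two hK _ hw, diagonalCount_add_two hK _ hw2,
      diagonalCount_add_two hK _ hw4, diagonalCount_fin_zero, if_pos rfl]
    have t2 : Fin.tail (Fin.tail w) 0 = w 2 := rfl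
    have t3 : Fin.tail (Fin.tail w) 1 = w 3 := rfl
    have t4 : Fin.tail (Fin.tail (Fin.tail (Fin.tail w))) 0 = w 4 := rfl
    have t5 : Fin.tail (Fin.tail (Fin.tail (Fin.tail w))) 1 = w 5 := rfl
    rw [t2, t3, t4, t5]
    ring

theorem diagonalCount_two_pos (hK : ringChar K ≠ 2) (w : Fin 2 → K) (hw : ∀ i, w i ≠ 0)
    {t : K} (ht : t ≠ 0) : 0 < diagonalCount w t := by
  rw [diagonalCount_add_two hK w hw, diagonalCount_fin_zero, if_neg ht]
  have hq : (1 : ℤ) < Fintype.card K := by exact_mod_cast Fintype.one_lt_card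
  rcases quadraticChar_dichotomy (neg_ne_zero.2 (mul_ne_zero (hw 0) (hw 1))) with h | h <;>
    rw [h] <;> linarith

end QuadricCount

section NondegenerateCount

variable {K V : Type*} [Field K] [AddCommGroup V] [Module K V] [FiniteDimensional K V]

/-- A nondegenerate quadratic form can be diagonalised, so that its level sets are counted by
`diagonalCount`. -/
theorem exists_ncard_eq_diagonalCount [Fintype K] [DecidableEq K] (h2 : (2 : K) ≠ 0)
    (Q : QuadraticForm K V) (hQ : Q.polarBilin.Nondegenerate) {n : ℕ}
    (hn : Module.finrank K V = n) :
    ∃ w : Fin n → K, (∀ i, w i ≠ 0) ∧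
      ∀ t, (({v | Q v = t} : Set V).ncard : ℤ) = diagonalCount w t := by
  subst hn
  let _ : Invertible (2 : K) := invertibleOfNonzero h2
  obtain ⟨w, ⟨e⟩⟩ := QuadraticForm.equivalent_weightedSumSquares_units_of_nondegenerate' Q (by
    intro x hx
    refine hQ.1 x fun y => ?_
    rw [← QuadraticMap.two_nsmul_associated K Q, LinearMap.smul_apply, LinearMap.smul_apply, hx y,
      smul_zero])
  refine ⟨fun i => w i, fun i => (w i).ne_zero, fun t => ?_⟩
  have h1 : ({v | Q v = t} : Set V)
      = e.toLinearEquiv ⁻¹' {x | ∑ i, (w i : K) * x i ^ 2 = t} := by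
    ext v
    have := e.map_app v
    rw [QuadraticMap.weightedSumSquares_apply] at this
    simp only [Set.mem_ofPred_eq, Set.mem_preimage]
    rw [← this]
    simp [Units.smul_def, sq]
  rw [h1, Set.ncard_preimage_of_injective_subset_range e.toLinearEquiv.injective
    (by simp), Set.ncard_eq_toFinset_card', diagonalCount,
    Finset.sum_boole]
  congr 2
  ext x
  simp

theorem ringChar_ne_two_of_two_ne_zero {K : Type*} [Field K] (h2 : (2 : K) ≠ 0) :
    ringChar K ≠ 2 := by
  intro h
  apply h2
  have := ringChar.Nat.cast_ringChar (R := K)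
  rw [h] at this
  exact_mod_cast this

theorem ncard_zeros_of_finrank_five [Finite K] (h2 : (2 : K) ≠ 0) (Q : QuadraticForm K V)
    (hQ : Q.polarBilin.Nondegenerate) (hn : Module.finrank K V = 5) :
    ({v | Q v = 0} : Set V).ncard = Nat.card K ^ 4 := by
  classical
  let _ := Fintype.ofFinite K
  obtain ⟨w, hw, h⟩ := exists_ncard_eq_diagonalCount h2 Q hQ hn
  have h3 := h 0
  rw [diagonalCount_five (ringChar_ne_two_of_two_ne_zero h2) w hw] at h3
  rw [Nat.card_eq_fintype_card]
  exact_mod_cast h3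

/-- The sign distinguishes the hyperbolic from the elliptic quadric of `PG(5,q)`. -/
theorem ncard_zeros_of_finrank_six [Finite K] (h2 : (2 : K) ≠ 0) (Q : QuadraticForm K V)
    (hQ : Q.polarBilin.Nondegenerate) (hn : Module.finrank K V = 6) :
    ∃ ε : ℤ, (ε = 1 ∨ ε = -1) ∧ (({v | Q v = 0} : Set V).ncard : ℤ)
      = (Nat.card K : ℤ) ^ 5 + ε * ((Nat.card K : ℤ) ^ 3 - (Nat.card K : ℤ) ^ 2) := by
  classical
  let _ := Fintype.ofFinite K
  obtain ⟨w, hw, h⟩ := exists_ncard_eq_diagonalCount h2 Q hQ hn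
  rw [h, Nat.card_eq_fintype_card]
  exact diagonalCount_six (ringChar_ne_two_of_two_ne_zero h2) w hw

theorem exists_apply_eq_of_finrank_two [Finite K] (h2 : (2 : K) ≠ 0) (Q : QuadraticForm K V)
    (hQ : Q.polarBilin.Nondegenerate) (hn : Module.finrank K V = 2) {t : K} (ht : t ≠ 0) :
    ∃ v, Q v = t := by
  classical
  let _ := Fintype.ofFinite K
  obtain ⟨w, hw, h⟩ := exists_ncard_eq_diagonalCount h2 Q hQ hn
  have h3 := diagonalCount_two_pos (ringChar_ne_two_of_two_ne_zero h2) w hw ht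
  rw [← h t] at h3
  exact Set.nonempty_of_ncard_ne_zero (by exact_mod_cast h3.ne')

end NondegenerateCount

/-! ### Counting subspaces and vectors -/

section Counting

theorem Set.ncard_mul_eq_ncard_mul {α β : Type*} [Finite α] [Finite β] {s : Set α} {t : Set β}
    (r : α → β → Prop) {m n : ℕ} (hm : ∀ a ∈ s, {b ∈ t | r a b}.ncard = m)
    (hn : ∀ b ∈ t, {a ∈ s | r a b}.ncard = n) : s.ncard * m = t.ncard * n := by
  classical
  let _ := Fintype.ofFinite α
  let _ := Fintype.ofFinite β
  rw [Set.ncard_eq_toFinset_card', Set.ncard_eq_toFinset_card']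
  refine Finset.card_mul_eq_card_mul r (fun a ha => ?_) (fun b hb => ?_)
  · rw [← hm a (by simpa using ha), Set.ncard_eq_toFinset_card']
    congr 1
    ext b
    simp [Finset.bipartiteAbove]
  · rw [← hn b (by simpa using hb), Set.ncard_eq_toFinset_card']
    congr 1
    ext a
    simp [Finset.bipartiteBelow]

open Module

variable {K V : Type*} [Field K] [Finite K] [AddCommGroup V] [Module K V] [FiniteDimensional K V]

omit [Finite K] in
theorem Submodule.ncard_coe_eq_pow (W : Submodule K V) :
    (W : Set V).ncard = Nat.card K ^ finrank K W := by
  rw [← Module.natCard_eq_pow_finrank, ← Nat.card_coe_set_eq]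
  rfl

theorem Submodule.ncard_mem_notMem {W' W : Submodule K V} (h : W' ≤ W) :
    {v | v ∈ W ∧ v ∉ W'}.ncard = Nat.card K ^ finrank K W - Nat.card K ^ finrank K W' := by
  have : Finite V := Module.finite_of_finite K
  rw [← ncard_coe_eq_pow, ← ncard_coe_eq_pow, ← Set.ncard_sdiff h]
  rfl

theorem Submodule.ncard_mem_ne_zero (W : Submodule K V) :
    {v | v ∈ W ∧ v ≠ 0}.ncard = Nat.card K ^ finrank K W - 1 := by
  simpa using ncard_mem_notMem (bot_le : ⊥ ≤ W)

omit [Finite K] in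
theorem exists_spanning_complement {l : Submodule K V} (hl : finrank K l = 2) {p : V} (hp : p ∈ l)
    (hp0 : p ≠ 0) :
    ∃ v ∈ l, v ∉ Submodule.span K {p} ∧ l = Submodule.span K {p, v} := by
  have hpl : Submodule.span K {p} ≤ l := by simpa using hp
  have hlt : Submodule.span K {p} < l := by
    refine lt_of_le_of_ne hpl fun h => ?_
    have := finrank_span_singleton (K := K) hp0
    rw [h, hl] at this
    omega
  obtain ⟨v, hv, hvp⟩ := SetLike.exists_of_lt hlt
  refine ⟨v, hv, hvp, ?_⟩
  symm
  refine Submodule.eq_of_le_of_finrank_le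
    (Submodule.span_le.2 (by simp [Set.insert_subset_iff, hp, hv])) ?_
  have hlt' : Submodule.span K {p} < Submodule.span K {p, v} := by
    refine lt_of_le_of_ne (Submodule.span_mono (by simp)) fun h => hvp ?_
    rw [h]
    exact Submodule.subset_span (by simp)
  have := Submodule.finrank_lt_finrank_of_lt hlt'
  rw [finrank_span_singleton hp0] at this
  omega

/-- A projective plane has `q + 1` lines through each of its points. -/
theorem ncard_finrank_two_between {E : Submodule K V} (hE : finrank K E = 3) {p : V} (hp : p ∈ E)
    (hp0 : p ≠ 0) :
    {l : Submodule K V | finrank K l = 2 ∧ p ∈ l ∧ l ≤ E}.ncard = Nat.card K + 1 := by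
  have : Finite V := Module.finite_of_finite K
  have : Finite (Submodule K V) := Finite.of_injective _ SetLike.coe_injective
  have hq : 1 < Nat.card K := Finite.one_lt_card
  have h1 := finrank_span_singleton (K := K) hp0
  -- the lines through `p` partition the vectors of `E` outside the span of `p`
  have key := Set.ncard_mul_eq_ncard_mul (s := {v | v ∈ E ∧ v ∉ Submodule.span K {p}})
    (t := {l : Submodule K V | finrank K l = 2 ∧ p ∈ l ∧ l ≤ E}) (fun v l => v ∈ l)
    (m := 1) (n := Nat.card K ^ 2 - Nat.card K) (by
      rintro v ⟨hv, hvp⟩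
      rw [Set.ncard_eq_one]
      refine ⟨Submodule.span K {p, v}, ?_⟩
      have hlt : Submodule.span K {p} < Submodule.span K {p, v} := by
        refine lt_of_le_of_ne (Submodule.span_mono (by simp)) fun h => hvp ?_
        rw [h]
        exact Submodule.subset_span (by simp)
      have h2 := Submodule.finrank_lt_finrank_of_lt hlt
      have h3 : finrank K (Submodule.span K {p, v}) ≤ 2 := by
        classical
        have := finrank_span_finset_le_card (R := K) ({p, v} : Finset V)
        rw [Finset.coe_pair] at this
        exact this.trans Finset.card_le_two
      ext l
      simp only [Set.mem_ofPred_eq, Set.mem_singleton_iff]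
      constructor
      · rintro ⟨⟨hl, hpl, -⟩, hvl⟩
        symm
        refine Submodule.eq_of_le_of_finrank_le
          (Submodule.span_le.2 (by simp [Set.insert_subset_iff, hpl, hvl])) (by omega)
      · rintro rfl
        exact ⟨⟨by omega, Submodule.subset_span (by simp),
          Submodule.span_le.2 (by simp [Set.insert_subset_iff, hp, hv])⟩,
          Submodule.subset_span (by simp)⟩)
    (by
      rintro l ⟨hl, hpl, hlE⟩
      have : {v ∈ {v | v ∈ E ∧ v ∉ Submodule.span K {p}} | v ∈ l}
          = {v | v ∈ l ∧ v ∉ Submodule.span K {p}} := by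
        ext v
        simp only [Set.mem_ofPred_eq]
        exact ⟨fun h => ⟨h.2, h.1.2⟩, fun h => ⟨⟨hlE h.1, h.2⟩, h.1⟩⟩
      rw [this, Submodule.ncard_mem_notMem (by simpa using hpl), hl, h1, pow_one])
  rw [Submodule.ncard_mem_notMem (by simpa using hp), hE, h1] at key
  generalize Set.ncard _ = N at key ⊢
  generalize Nat.card K = q at key hq ⊢
  obtain ⟨k, rfl⟩ : ∃ k, q = k + 2 := ⟨q - 2, by omega⟩
  have e1 : (k + 2) ^ 2 - (k + 2) = (k + 2) * (k + 1) := by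
    rw [Nat.sub_eq_iff_eq_add (by nlinarith)]; ring
  have e2 : (k + 2) ^ 3 - (k + 2) ^ 1 = (k + 3) * ((k + 2) * (k + 1)) := by
    rw [Nat.sub_eq_iff_eq_add (Nat.pow_le_pow_right (by omega) (by omega))]; ring
  rw [e1, e2, mul_one] at key
  exact (Nat.eq_of_mul_eq_mul_right (by positivity) key).symm

end Counting

/-! ### Orthogonality -/

section Polar

open Module QuadraticMap

variable {K V : Type*} [Field K] [AddCommGroup V] [Module K V]
variable {Q : QuadraticForm K V}

theorem mem_polarPerp {W : Submodule K V} {x : V} :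
    x ∈ polarPerp Q W ↔ ∀ y ∈ W, polar Q y x = 0 := by
  rw [polarPerp, LinearMap.BilinForm.mem_orthogonal_iff]
  rfl

theorem mem_polarPerp_span_singleton {v x : V} :
    x ∈ polarPerp Q (Submodule.span K {v}) ↔ polar Q v x = 0 := by
  rw [mem_polarPerp]
  refine ⟨fun h => h v (Submodule.mem_span_singleton_self v), fun h y hy => ?_⟩
  obtain ⟨a, rfl⟩ := Submodule.mem_span_singleton.1 hy
  rw [polar_smul_left, h, smul_zero]

theorem polarPerp_anti {W W' : Submodule K V} (h : W ≤ W') : polarPerp Q W' ≤ polarPerp Q W :=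
  LinearMap.BilinForm.orthogonal_le h

theorem polarBilin_isRefl (Q : QuadraticForm K V) : LinearMap.BilinForm.IsRefl Q.polarBilin := by
  intro x y h
  rw [polarBilin_apply_apply] at h ⊢
  rw [polar_comm, h]

theorem IsTotallySingular.polar_eq_zero {W : Submodule K V} (h : IsTotallySingular Q W) {x y : V}
    (hx : x ∈ W) (hy : y ∈ W) : polar Q x y = 0 := by
  rw [polar, h _ (W.add_mem hx hy), h x hx, h y hy]
  simp

theorem IsTotallySingular.le_polarPerp {W : Submodule K V} (h : IsTotallySingular Q W) :
    W ≤ polarPerp Q W :=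
  fun _ hx => mem_polarPerp.2 fun _ hy => h.polar_eq_zero hy hx

theorem IsTotallySingular.sup {W W' : Submodule K V} (h : IsTotallySingular Q W)
    (h' : IsTotallySingular Q W') (hp : W' ≤ polarPerp Q W) : IsTotallySingular Q (W ⊔ W') := by
  intro v hv
  obtain ⟨x, hx, y, hy, rfl⟩ := Submodule.mem_sup.1 hv
  rw [QuadraticMap.map_add Q, h x hx, h' y hy, mem_polarPerp.1 (hp hy) x hx]
  simp

/-- The restriction of a nondegenerate form to a subspace meeting its perp trivially. -/
theorem polarBilin_comp_subtype_nondegenerate {W : Submodule K V}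
    (h : Disjoint W (polarPerp Q W)) : (Q.comp W.subtype).polarBilin.Nondegenerate :=
  LinearMap.BilinForm.nondegenerate_restrict_of_disjoint_orthogonal Q.polarBilin
    (polarBilin_isRefl Q) h

variable [FiniteDimensional K V]

theorem finrank_polarPerp (hQ : Q.polarBilin.Nondegenerate) (W : Submodule K V) :
    finrank K (polarPerp Q W) = finrank K V - finrank K W :=
  LinearMap.BilinForm.finrank_orthogonal hQ W

theorem polarPerp_polarPerp (hQ : Q.polarBilin.Nondegenerate) (W : Submodule K V) :
    polarPerp Q (polarPerp Q W) = W :=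
  LinearMap.BilinForm.orthogonal_orthogonal hQ (polarBilin_isRefl Q) W

theorem disjoint_polarPerp_polarPerp (hQ : Q.polarBilin.Nondegenerate) {W : Submodule K V}
    (h : Disjoint W (polarPerp Q W)) : Disjoint (polarPerp Q W) (polarPerp Q (polarPerp Q W)) := by
  rw [polarPerp_polarPerp hQ]
  exact h.symm

theorem IsTotallySingular.two_mul_finrank_le (hQ : Q.polarBilin.Nondegenerate) {W : Submodule K V}
    (h : IsTotallySingular Q W) : 2 * finrank K W ≤ finrank K V := by
  have h1 := Submodule.finrank_mono h.le_polarPerp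
  rw [finrank_polarPerp hQ] at h1
  have := Submodule.finrank_le W
  omega

theorem finrank_le_finrank_inf_polarPerp_span_add_one (W : Submodule K V) (v : V) :
    finrank K W ≤ finrank K (W ⊓ polarPerp Q (Submodule.span K {v}) : Submodule K V) + 1 := by
  have h1 := Submodule.finrank_sup_add_finrank_inf_eq W (polarPerp Q (Submodule.span K {v}))
  have h2 := Submodule.finrank_le (W ⊔ polarPerp Q (Submodule.span K {v}))
  have h3 := LinearMap.BilinForm.finrank_add_finrank_orthogonal (polarBilin_isRefl Q)
    (Submodule.span K {v})
  have h4 : finrank K (Submodule.span K {v}) ≤ 1 := by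
    simpa using finrank_span_le_card (R := K) ({v} : Set V)
  change _ + finrank K (polarPerp Q (Submodule.span K {v})) = _ at h3
  omega

omit [FiniteDimensional K V] in
theorem ncard_zeros_mem (W : Submodule K V) :
    {v | v ∈ W ∧ Q v = 0}.ncard = ({v | Q.comp W.subtype v = 0} : Set W).ncard := by
  rw [← Set.ncard_image_of_injective _ W.subtype_injective]
  congr 1
  ext v
  simp [and_comm]

/-- A line that has `0` or at least two points on the quadric is totally singular or
nondegenerate. -/
theorem isTotallySingular_or_disjoint_polarPerp (h2 : (2 : K) ≠ 0) {l : Submodule K V}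
    (hl : finrank K l = 2) (hc : (singularPointsIn Q l).ncard ≠ 1) :
    IsTotallySingular Q l ∨ Disjoint l (polarPerp Q l) := by
  by_contra! hcon
  obtain ⟨h1, h3⟩ := hcon
  obtain ⟨r, hr, hr0⟩ := Submodule.exists_mem_ne_zero_of_ne_bot (fun h => h3 (disjoint_iff.2 h))
  have hrl := (Submodule.mem_inf.1 hr).1
  have hrp := mem_polarPerp.1 (Submodule.mem_inf.1 hr).2
  have hQr : Q r = 0 := by
    have := hrp r hrl
    rw [polar_self, nsmul_eq_mul] at this
    simpa [h2] using this
  obtain ⟨v, hv, -, hlv⟩ := exists_spanning_complement hl hrl hr0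
  have hQ : ∀ a b : K, Q (a • r + b • v) = b * b * Q v := by
    intro a b
    rw [QuadraticMap.map_add Q, QuadraticMap.map_smul, QuadraticMap.map_smul, hQr,
      polar_smul_left, polar_smul_right, polar_comm, hrp v hv]
    simp
  have hQv : Q v ≠ 0 := by
    intro hQv
    refine h1 fun x hx => ?_
    rw [hlv] at hx
    obtain ⟨a, b, rfl⟩ := Submodule.mem_span_pair.1 hx
    rw [hQ, hQv, mul_zero]
  apply hc
  rw [Set.ncard_eq_one]
  refine ⟨Submodule.span K {r}, ?_⟩
  ext P
  simp only [singularPointsIn, Set.mem_ofPred_eq, Set.mem_singleton_iff]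
  constructor
  · rintro ⟨hP, hPs, hPl⟩
    refine Submodule.eq_of_le_of_finrank_le (fun x hx => ?_)
      (by rw [hP, finrank_span_singleton hr0])
    have hxl := hPl hx
    rw [hlv] at hxl
    obtain ⟨a, b, rfl⟩ := Submodule.mem_span_pair.1 hxl
    have := hPs _ hx
    rw [hQ] at this
    have hb : b = 0 := by simpa [hQv] using this
    rw [hb, zero_smul, add_zero]
    exact Submodule.smul_mem _ _ (Submodule.mem_span_singleton_self r)
  · rintro rfl
    refine ⟨finrank_span_singleton hr0, fun x hx => ?_, by simpa using hrl⟩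
    obtain ⟨a, rfl⟩ := Submodule.mem_span_singleton.1 hx
    rw [QuadraticMap.map_smul, hQr, smul_zero]

end Polar

/-! ### Vector products and the lines they define -/

section VectorProduct

open Module QuadraticMap

variable {K V : Type*} [Field K] [AddCommGroup V] [Module K V]

/-- The alternating bilinear map `cr` is a vector product for the quadratic form `Q`.  It is
normalised like the commutator `xy - yx` of trace zero octonions, so that no
denominators occur. -/
structure IsVectorProduct (Q : QuadraticForm K V) (cr : V →ₗ[K] V →ₗ[K] V) : Prop where
  cr_self : ∀ x, cr x x = 0
  cr_cr : ∀ x y, cr x (cr x y) = (2 * polar Q x y) • x - (4 * Q x) • y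
  map_cr : ∀ x y, Q (cr x y) = 4 * Q x * Q y - polar Q x y ^ 2
  polar_cr : ∀ x y z, polar Q (cr x y) z = polar Q x (cr y z)

/-- The totally singular lines on which the vector product vanishes: the lines of the hexagon. -/
def vectorProductLines (Q : QuadraticForm K V) (cr : V →ₗ[K] V →ₗ[K] V) : Set (Submodule K V) :=
  {l | finrank K l = 2 ∧ IsTotallySingular Q l ∧ ∀ x ∈ l, ∀ y ∈ l, cr x y = 0}

namespace IsVectorProduct

variable {Q : QuadraticForm K V} {cr : V →ₗ[K] V →ₗ[K] V}

theorem cr_swap (h : IsVectorProduct Q cr) (x y : V) : cr x y = -cr y x := by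
  have := h.cr_self (x + y)
  simp only [map_add, LinearMap.add_apply, h.cr_self, zero_add, add_zero] at this
  exact eq_neg_of_add_eq_zero_right this

theorem isTotallySingular_ker (h : IsVectorProduct Q cr) (h2 : (2 : K) ≠ 0) {p : V} (hp : Q p = 0)
    (hp0 : p ≠ 0) : IsTotallySingular Q (LinearMap.ker (cr p)) := by
  intro y hy
  rw [LinearMap.mem_ker] at hy
  have h1 := h.cr_cr p y
  rw [hy, map_zero, hp, mul_zero, zero_smul, sub_zero, eq_comm, smul_eq_zero] at h1
  have hpol : polar Q p y = 0 := by simpa [h2, hp0] using h1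
  have h3 := h.cr_cr y p
  rw [h.cr_swap y p, hy, neg_zero, map_zero, polar_comm, hpol, mul_zero, zero_smul, zero_sub,
    eq_comm, neg_eq_zero, smul_eq_zero] at h3
  have h4 : (4 : K) ≠ 0 := by
    rw [show (4 : K) = 2 * 2 by norm_num]
    exact mul_ne_zero h2 h2
  simpa [h4, hp0] using h3

theorem mem_ker_self (h : IsVectorProduct Q cr) (p : V) : p ∈ LinearMap.ker (cr p) :=
  h.cr_self p

theorem le_ker_of_mem_lines {l : Submodule K V} (hl : l ∈ vectorProductLines Q cr) {p : V}
    (hp : p ∈ l) : l ≤ LinearMap.ker (cr p) :=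
  fun y hy => hl.2.2 p hp y hy

variable [FiniteDimensional K V]

/-- The points that are joined to a given point by lines of the hexagon form a plane: the square
of `cr p` has rank at most one, so that its kernel has dimension at least three, and no totally
singular subspace is larger. -/
theorem finrank_ker (h : IsVectorProduct Q cr) (hQ : Q.polarBilin.Nondegenerate)
    (hV : finrank K V = 7) (h2 : (2 : K) ≠ 0) {p : V} (hp : Q p = 0) (hp0 : p ≠ 0) :
    finrank K (LinearMap.ker (cr p)) = 3 := by
  have hle := (h.isTotallySingular_ker h2 hp hp0).two_mul_finrank_le hQ
  have h1 := LinearMap.finrank_range_add_finrank_ker (cr p)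
  have h3 := LinearMap.finrank_range_add_finrank_ker ((cr p).domRestrict (LinearMap.range (cr p)))
  have h4 : finrank K (LinearMap.range ((cr p).domRestrict (LinearMap.range (cr p)))) ≤ 1 := by
    rw [← finrank_span_singleton (K := K) hp0]
    refine Submodule.finrank_mono ?_
    rintro _ ⟨⟨_, ⟨y, rfl⟩⟩, rfl⟩
    rw [LinearMap.domRestrict_apply, h.cr_cr, hp, mul_zero, zero_smul, sub_zero]
    exact Submodule.smul_mem _ _ (Submodule.mem_span_singleton_self p)
  have h5 : finrank K (LinearMap.ker ((cr p).domRestrict (LinearMap.range (cr p))))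
      ≤ finrank K (LinearMap.ker (cr p)) := by
    rw [← Submodule.finrank_map_subtype_eq]
    refine Submodule.finrank_mono ?_
    rintro _ ⟨⟨x, hx⟩, hx', rfl⟩
    exact hx'
  omega

/-- If `w` is perpendicular to the plane of a point `p`, then the hyperplane `w^⊥` is not
elliptic: `w` has the form `cr p y`, and `Q (cr p y) = -(polar Q p y)²`. -/
theorem isSquare_neg_of_ker_le (h : IsVectorProduct Q cr) (hQ : Q.polarBilin.Nondegenerate)
    {p w : V} (hp : Q p = 0) (hw : LinearMap.ker (cr p) ≤ polarPerp Q (Submodule.span K {w})) :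
    IsSquare (-Q w) := by
  have hr : LinearMap.range (cr p) = polarPerp Q (LinearMap.ker (cr p)) := by
    refine Submodule.eq_of_le_of_finrank_le ?_ ?_
    · rintro _ ⟨y, rfl⟩
      refine mem_polarPerp.2 fun z hz => ?_
      rw [← h.polar_cr, h.cr_swap, LinearMap.mem_ker.1 hz, neg_zero, polar_zero_left]
    · rw [finrank_polarPerp hQ]
      have := LinearMap.finrank_range_add_finrank_ker (cr p)
      omega
  have hw' : w ∈ LinearMap.range (cr p) := by
    rw [hr]
    refine mem_polarPerp.2 fun z hz => ?_
    rw [polar_comm]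
    exact mem_polarPerp_span_singleton.1 (hw hz)
  obtain ⟨y, rfl⟩ := hw'
  refine ⟨polar Q p y, ?_⟩
  rw [h.map_cr, hp]
  ring

theorem mem_lines_of_le_ker (h : IsVectorProduct Q cr) (h2 : (2 : K) ≠ 0) {p : V} (hp : Q p = 0)
    (hp0 : p ≠ 0) {l : Submodule K V} (hl : finrank K l = 2) (hpl : p ∈ l)
    (hle : l ≤ LinearMap.ker (cr p)) : l ∈ vectorProductLines Q cr := by
  refine ⟨hl, fun v hv => h.isTotallySingular_ker h2 hp hp0 v (hle hv), ?_⟩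
  obtain ⟨v, hv, -, hlv⟩ := exists_spanning_complement hl hpl hp0
  have hpv : cr p v = 0 := hle hv
  have hvp : cr v p = 0 := by rw [h.cr_swap, hpv, neg_zero]
  rw [hlv]
  intro x hx y hy
  obtain ⟨a, b, rfl⟩ := Submodule.mem_span_pair.1 hx
  obtain ⟨c, d, rfl⟩ := Submodule.mem_span_pair.1 hy
  simp [hpv, hvp, h.cr_self]

theorem lines_through_eq (h : IsVectorProduct Q cr) (h2 : (2 : K) ≠ 0) {p : V} (hp : Q p = 0)
    (hp0 : p ≠ 0) : {l ∈ vectorProductLines Q cr | p ∈ l}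
      = {l : Submodule K V | finrank K l = 2 ∧ p ∈ l ∧ l ≤ LinearMap.ker (cr p)} := by
  ext l
  exact ⟨fun hl => ⟨hl.1.1, hl.2, le_ker_of_mem_lines hl.1 hl.2⟩,
    fun hl => ⟨h.mem_lines_of_le_ker h2 hp hp0 hl.1 hl.2.1 hl.2.2, hl.2.1⟩⟩

theorem ncard_lines_through [Finite K] (h : IsVectorProduct Q cr) (hQ : Q.polarBilin.Nondegenerate)
    (hV : finrank K V = 7) (h2 : (2 : K) ≠ 0) {p : V} (hp : Q p = 0) (hp0 : p ≠ 0) :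
    {l ∈ vectorProductLines Q cr | p ∈ l}.ncard = Nat.card K + 1 := by
  rw [h.lines_through_eq h2 hp hp0,
    ncard_finrank_two_between (h.finrank_ker hQ hV h2 hp hp0) (h.mem_ker_self p) hp0]

/-- If `v^⊥` contains the point `p` but not its plane, then it contains exactly one line of the
hexagon through `p`. -/
theorem ncard_lines_through_le_perp (h : IsVectorProduct Q cr) (hQ : Q.polarBilin.Nondegenerate)
    (hV : finrank K V = 7) (h2 : (2 : K) ≠ 0) {p v : V} (hp : Q p = 0) (hp0 : p ≠ 0)
    (hpv : polar Q v p = 0)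
    (hv : ¬ LinearMap.ker (cr p) ≤ polarPerp Q (Submodule.span K {v})) :
    {l ∈ vectorProductLines Q cr | p ∈ l ∧ l ≤ polarPerp Q (Submodule.span K {v})}.ncard = 1 := by
  have h3 := h.finrank_ker hQ hV h2 hp hp0
  have h4 := finrank_le_finrank_inf_polarPerp_span_add_one (Q := Q) (LinearMap.ker (cr p)) v
  have h5 : LinearMap.ker (cr p) ⊓ polarPerp Q (Submodule.span K {v}) < LinearMap.ker (cr p) :=
    inf_le_left.lt_of_ne fun h => hv (inf_eq_left.1 h)
  have h6 := Submodule.finrank_lt_finrank_of_lt h5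
  rw [Set.ncard_eq_one]
  refine ⟨LinearMap.ker (cr p) ⊓ polarPerp Q (Submodule.span K {v}), ?_⟩
  ext l
  simp only [Set.mem_ofPred_eq, Set.mem_singleton_iff]
  constructor
  · rintro ⟨hl, hpl, hlv⟩
    refine Submodule.eq_of_le_of_finrank_le (le_inf (le_ker_of_mem_lines hl hpl) hlv) ?_
    rw [hl.1]
    omega
  · rintro rfl
    have hmem : p ∈ LinearMap.ker (cr p) ⊓ polarPerp Q (Submodule.span K {v}) :=
      ⟨h.mem_ker_self p, mem_polarPerp_span_singleton.2 hpv⟩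
    exact ⟨h.mem_lines_of_le_ker h2 hp hp0 (by omega) hmem inf_le_left, hmem, inf_le_right⟩

end IsVectorProduct

end VectorProduct

/-! ### Hexagon lines in the perp of a totally singular line -/

section TotallySingularLine

open Module QuadraticMap

variable {K V : Type*} [Field K] [Finite K] [AddCommGroup V] [Module K V] [FiniteDimensional K V]
variable {Q : QuadraticForm K V}

/-- In the perp of a totally singular line `l` of `Q(6,q)`, every other totally singular line meets
`l` in a point, since their span is totally singular.  So such lines can be counted through the
points of `l`. -/
theorem ncard_of_forall_ncard_through (hQ : Q.polarBilin.Nondegenerate) (hV : finrank K V = 7)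
    {l : Submodule K V} (hl : finrank K l = 2) (hls : IsTotallySingular Q l)
    {T : Set (Submodule K V)}
    (hT : ∀ s ∈ T, finrank K s = 2 ∧ IsTotallySingular Q s ∧ s ≤ polarPerp Q l ∧ s ≠ l) {k : ℕ}
    (hk : ∀ p ∈ l, p ≠ 0 → {s ∈ T | p ∈ s}.ncard = k) : T.ncard = k * (Nat.card K + 1) := by
  have : Finite V := Module.finite_of_finite K
  have : Finite (Submodule K V) := Finite.of_injective _ SetLike.coe_injective
  have hq : 1 < Nat.card K := Finite.one_lt_card
  have key := Set.ncard_mul_eq_ncard_mul (s := {v | v ∈ l ∧ v ≠ 0}) (t := T) (fun v s => v ∈ s)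
    (m := k) (n := Nat.card K - 1) (fun p hp => hk p hp.1 hp.2) (by
      intro s hs
      obtain ⟨h1, h2, h3, h4⟩ := hT s hs
      have h5 := (hls.sup h2 h3).two_mul_finrank_le hQ
      have h6 := Submodule.finrank_sup_add_finrank_inf_eq l s
      have h7 : finrank K (l ⊓ s : Submodule K V) ≠ 2 := by
        intro h7
        have e1 : l ⊓ s = l := Submodule.eq_of_le_of_finrank_le inf_le_left (by omega)
        have e2 : l ⊓ s = s := Submodule.eq_of_le_of_finrank_le inf_le_right (by omega)
        exact h4 (e2.symm.trans e1)
      have h8 := Submodule.finrank_mono (inf_le_left : l ⊓ s ≤ l)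
      have h9 : finrank K (l ⊓ s : Submodule K V) = 1 := by omega
      have : {v ∈ {v | v ∈ l ∧ v ≠ 0} | v ∈ s} = {v | v ∈ l ⊓ s ∧ v ≠ 0} := by
        ext v
        simp only [Set.mem_ofPred_eq, Submodule.mem_inf]
        tauto
      rw [this, Submodule.ncard_mem_ne_zero, h9, pow_one])
  rw [Submodule.ncard_mem_ne_zero, hl] at key
  generalize T.ncard = N at key ⊢
  generalize Nat.card K = q at key hq ⊢
  obtain ⟨j, rfl⟩ : ∃ j, q = j + 2 := ⟨q - 2, by omega⟩
  have e1 : (j + 2) ^ 2 - 1 = (j + 3) * (j + 1) := by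
    rw [Nat.sub_eq_iff_eq_add (Nat.one_le_pow _ _ (by omega))]; ring
  rw [e1, show j + 2 - 1 = j + 1 by omega] at key
  refine Nat.eq_of_mul_eq_mul_right (Nat.add_pos_right j one_pos) ?_
  rw [← key]
  ring

variable {cr : V →ₗ[K] V →ₗ[K] V}

theorem IsVectorProduct.ncard_lines_le_perp_of_mem (h : IsVectorProduct Q cr)
    (hQ : Q.polarBilin.Nondegenerate) (hV : finrank K V = 7) (h2 : (2 : K) ≠ 0)
    {l : Submodule K V} (hl : l ∈ vectorProductLines Q cr) :
    {s ∈ vectorProductLines Q cr | s ≤ polarPerp Q l}.ncard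
      = Nat.card K * (Nat.card K + 1) + 1 := by
  have : Finite V := Module.finite_of_finite K
  have : Finite (Submodule K V) := Finite.of_injective _ SetLike.coe_injective
  have h1 := ncard_of_forall_ncard_through hQ hV hl.1 hl.2.1
    (T := {s ∈ vectorProductLines Q cr | s ≤ polarPerp Q l} \ {l}) (k := Nat.card K)
    (fun s hs => ⟨hs.1.1.1, hs.1.1.2.1, hs.1.2, hs.2⟩) (by
      intro p hpl hp0
      have hp : Q p = 0 := hl.2.1 p hpl
      have hE : {s ∈ {s ∈ vectorProductLines Q cr | s ≤ polarPerp Q l} \ {l} | p ∈ s}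
          = {s ∈ vectorProductLines Q cr | p ∈ s} \ {l} := by
        ext s
        constructor
        · exact fun hs => ⟨⟨hs.1.1.1, hs.2⟩, hs.1.2⟩
        · refine fun hs => ⟨⟨⟨hs.1.1, fun x hx => mem_polarPerp.2 fun y hy => ?_⟩, hs.2⟩, hs.1.2⟩
          -- both lines lie in the totally singular plane of `p`
          exact (h.isTotallySingular_ker h2 hp hp0).polar_eq_zero
            (le_ker_of_mem_lines hl hpl hy) (le_ker_of_mem_lines hs.1.1 hs.1.2 hx)
      have hlp : l ∈ {s ∈ vectorProductLines Q cr | p ∈ s} := ⟨hl, hpl⟩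
      rw [hE, Set.ncard_sdiff_singleton_of_mem hlp, h.ncard_lines_through hQ hV h2 hp hp0,
        Nat.add_sub_cancel])
  have hll : l ∈ {s ∈ vectorProductLines Q cr | s ≤ polarPerp Q l} := ⟨hl, hl.2.1.le_polarPerp⟩
  rw [← h1, Set.ncard_sdiff_singleton_add_one hll]

theorem IsVectorProduct.ncard_lines_le_perp_of_isTotallySingular (h : IsVectorProduct Q cr)
    (hQ : Q.polarBilin.Nondegenerate) (hV : finrank K V = 7) (h2 : (2 : K) ≠ 0)
    {l : Submodule K V} (hl : finrank K l = 2) (hls : IsTotallySingular Q l)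
    (hmem : l ∉ vectorProductLines Q cr) :
    {s ∈ vectorProductLines Q cr | s ≤ polarPerp Q l}.ncard = Nat.card K + 1 := by
  rw [← one_mul (Nat.card K + 1)]
  refine ncard_of_forall_ncard_through hQ hV hl hls
    (fun s hs => ⟨hs.1.1, hs.1.2.1, hs.2, fun h => hmem (h ▸ hs.1)⟩) fun p hpl hp0 => ?_
  have hp : Q p = 0 := hls p hpl
  obtain ⟨v, hv, -, hlv⟩ := exists_spanning_complement hl hpl hp0
  have hE : {s ∈ {s ∈ vectorProductLines Q cr | s ≤ polarPerp Q l} | p ∈ s}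
      = {s ∈ vectorProductLines Q cr | p ∈ s ∧ s ≤ polarPerp Q (Submodule.span K {v})} := by
    ext s
    constructor
    · exact fun hs => ⟨hs.1.1, hs.2, hs.1.2.trans (polarPerp_anti (by simpa using hv))⟩
    · refine fun hs => ⟨⟨hs.1, fun x hx => mem_polarPerp.2 fun y hy => ?_⟩, hs.2.1⟩
      rw [hlv] at hy
      obtain ⟨a, b, rfl⟩ := Submodule.mem_span_pair.1 hy
      rw [polar_add_left, polar_smul_left, polar_smul_left,
        hs.1.2.1.polar_eq_zero hs.2.1 hx, mem_polarPerp_span_singleton.1 (hs.2.2 hx)]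
      simp
  rw [hE]
  refine h.ncard_lines_through_le_perp hQ hV h2 hp hp0 (hls.polar_eq_zero hv hpl) fun hle => ?_
  -- otherwise the span of `l` and the plane of `p` is totally singular, so that `l` is in the plane
  have hEs := h.isTotallySingular_ker h2 hp hp0
  have hsup : IsTotallySingular Q (LinearMap.ker (cr p) ⊔ l) := by
    refine hEs.sup hls fun x hx => mem_polarPerp.2 fun y hy => ?_
    rw [hlv] at hx
    obtain ⟨a, b, rfl⟩ := Submodule.mem_span_pair.1 hx
    rw [polar_add_right, polar_smul_right, polar_smul_right,
      hEs.polar_eq_zero hy (h.mem_ker_self p), polar_comm Q y v,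
      mem_polarPerp_span_singleton.1 (hle hy)]
    simp
  have h3 := hsup.two_mul_finrank_le hQ
  have h4 := h.finrank_ker hQ hV h2 hp hp0
  have h5 : LinearMap.ker (cr p) = LinearMap.ker (cr p) ⊔ l :=
    Submodule.eq_of_le_of_finrank_le le_sup_left (by omega)
  exact hmem (h.mem_lines_of_le_ker h2 hp hp0 hl hpl (sup_eq_left.1 h5.symm))

end TotallySingularLine

/-! ### Hexagon lines in the perp of a nondegenerate line -/

section NondegenerateLine

open Module QuadraticMap

/-- The arithmetic of the count below.  Here `S` is the number of hexagon lines in the hyperplane,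
`A` the number of those in the perp of the line, and `Z` the number of zeros of the form in the
hyperplane.  Divisibility excludes the sign `ε = 1` of a hyperbolic quadric. -/
theorem eq_add_one_of_line_counts {q S A Z ε : ℤ} (hq : 2 < q) (hε : ε = 1 ∨ ε = -1)
    (hZ : Z = q ^ 5 + ε * (q ^ 3 - q ^ 2)) (h1 : Z - 1 = S * (q ^ 2 - 1))
    (h2 : Z - q ^ 4 = (S - A) * (q ^ 2 - q)) : A = q + 1 := by
  rcases hε with rfl | rfl
  · exfalso
    have h3 : (S - (q ^ 3 + 2 * q - 1)) * (q + 1) = 2 := by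
      have : (q - 1) * ((S - (q ^ 3 + 2 * q - 1)) * (q + 1) - 2) = 0 := by
        linear_combination hZ - h1
      rcases mul_eq_zero.1 this with h | h <;> linarith
    have := Int.le_of_dvd (by norm_num) (Dvd.intro_left _ h3)
    linarith
  · have h3 : S = q ^ 3 + 1 := by
      have : (q ^ 2 - 1) * (S - (q ^ 3 + 1)) = 0 := by linear_combination hZ - h1
      rcases mul_eq_zero.1 this with h | h
      · nlinarith
      · linarith
    have h4 : (q ^ 2 - q) * (A - (q + 1)) = 0 := by
      rw [hZ, h3] at h2
      linear_combination h2
    rcases mul_eq_zero.1 h4 with h | h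
    · nlinarith
    · linarith

variable {K V : Type*} [Field K] [Finite K] [AddCommGroup V] [Module K V] [FiniteDimensional K V]
variable {Q : QuadraticForm K V} {cr : V →ₗ[K] V →ₗ[K] V}

omit [Finite K] [FiniteDimensional K V] in
theorem disjoint_span_singleton_polarPerp (h2 : (2 : K) ≠ 0) {w : V} (hw : Q w ≠ 0) :
    Disjoint (Submodule.span K {w}) (polarPerp Q (Submodule.span K {w})) := by
  rw [Submodule.disjoint_def]
  intro x hx hx'
  obtain ⟨a, rfl⟩ := Submodule.mem_span_singleton.1 hx
  rw [mem_polarPerp_span_singleton, polar_smul_right, polar_self, nsmul_eq_mul] at hx'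
  have : a = 0 := by simpa [h2, hw] using hx'
  rw [this, zero_smul]

/-- If `-Q w` is not a square, the hexagon lines in the hyperplane `w^⊥` form a spread: they
partition the points of the quadric in this hyperplane.  Each of them either lies in a given
hyperplane of `w^⊥` or meets it in a point. -/
theorem IsVectorProduct.ncard_lines_le_perp_of_disjoint (h : IsVectorProduct Q cr)
    (hQ : Q.polarBilin.Nondegenerate) (hV : finrank K V = 7) (hodd : Odd (Nat.card K))
    (h2 : (2 : K) ≠ 0) {l : Submodule K V} (hl : finrank K l = 2)
    (hdisj : Disjoint l (polarPerp Q l)) :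
    {s ∈ vectorProductLines Q cr | s ≤ polarPerp Q l}.ncard = Nat.card K + 1 := by
  have : Finite V := Module.finite_of_finite K
  have : Finite (Submodule K V) := Finite.of_injective _ SetLike.coe_injective
  have hq : 2 < Nat.card K := by
    have : 1 < Nat.card K := Finite.one_lt_card
    obtain ⟨k, hk⟩ := hodd
    omega
  -- a nondegenerate binary form represents every nonzero scalar
  obtain ⟨n, hn⟩ := FiniteField.exists_nonsquare (ringChar_ne_two_of_two_ne_zero h2)
  have hn0 : n ≠ 0 := fun h0 => hn (h0 ▸ IsSquare.zero)
  obtain ⟨⟨w, hwl⟩, hw⟩ := exists_apply_eq_of_finrank_two h2 (Q.comp l.subtype)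
    (polarBilin_comp_subtype_nondegenerate hdisj) hl (neg_ne_zero.2 hn0)
  have hQw : Q w = -n := hw
  have hQw0 : Q w ≠ 0 := by rw [hQw]; exact neg_ne_zero.2 hn0
  have hw0 : w ≠ 0 := fun h0 => hQw0 (by rw [h0, map_zero])
  set H := polarPerp Q (Submodule.span K {w}) with hH
  set D := polarPerp Q l with hD
  have hDH : D ≤ H := polarPerp_anti (by simpa using hwl)
  have hHr : finrank K H = 6 := by
    rw [hH, finrank_polarPerp hQ, hV, finrank_span_singleton hw0]
  have hDr : finrank K D = 5 := by rw [hD, finrank_polarPerp hQ, hV, hl]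
  obtain ⟨ε, hε, hZ⟩ := ncard_zeros_of_finrank_six h2 (Q.comp H.subtype)
    (polarBilin_comp_subtype_nondegenerate
      (disjoint_polarPerp_polarPerp hQ (disjoint_span_singleton_polarPerp h2 hQw0))) hHr
  rw [← ncard_zeros_mem] at hZ
  have hZD := ncard_zeros_of_finrank_five h2 (Q.comp D.subtype)
    (polarBilin_comp_subtype_nondegenerate (disjoint_polarPerp_polarPerp hQ hdisj)) hDr
  rw [← ncard_zeros_mem] at hZD
  set L := vectorProductLines Q cr with hL
  -- the spread property
  have hone : ∀ p ∈ H, Q p = 0 → p ≠ 0 → {s ∈ L | p ∈ s ∧ s ≤ H}.ncard = 1 := by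
    intro p hpH hp hp0
    refine h.ncard_lines_through_le_perp hQ hV h2 hp hp0 (mem_polarPerp_span_singleton.1 hpH)
      fun hle => hn ?_
    have := h.isSquare_neg_of_ker_le hQ hp hle
    rwa [hQw, neg_neg] at this
  have c1 := Set.ncard_mul_eq_ncard_mul (s := {v | v ∈ H ∧ Q v = 0} \ {0})
    (t := {s ∈ L | s ≤ H}) (fun v s => v ∈ s) (m := 1) (n := Nat.card K ^ 2 - 1)
    (by
      rintro p ⟨⟨hpH, hp⟩, hp0⟩
      rw [← hone p hpH hp hp0]
      congr 1
      ext s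
      simp only [Set.mem_ofPred_eq]
      tauto)
    (by
      rintro s ⟨hs, hsH⟩
      rw [← hs.1, ← Submodule.ncard_mem_ne_zero]
      congr 1
      ext v
      exact ⟨fun hv => ⟨hv.2, hv.1.2⟩, fun hv => ⟨⟨⟨hsH hv.1, hs.2.1 v hv.1⟩, hv.2⟩, hv.1⟩⟩)
  have c2 := Set.ncard_mul_eq_ncard_mul
    (s := {v | v ∈ H ∧ Q v = 0} \ {v | v ∈ D ∧ Q v = 0})
    (t := {s ∈ L | s ≤ H} \ {s ∈ L | s ≤ D}) (fun v s => v ∈ s) (m := 1)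
    (n := Nat.card K ^ 2 - Nat.card K)
    (by
      rintro p ⟨⟨hpH, hp⟩, hpD⟩
      have hpD' : p ∉ D := fun h => hpD ⟨h, hp⟩
      rw [← hone p hpH hp fun h0 => hpD' (h0 ▸ D.zero_mem)]
      congr 1
      ext s
      exact ⟨fun hs => ⟨hs.1.1.1, hs.2, hs.1.1.2⟩,
        fun hs => ⟨⟨⟨hs.1, hs.2.2⟩, fun h' => hpD' (h'.2 hs.2.1)⟩, hs.2.1⟩⟩)
    (by
      rintro s ⟨⟨hs, hsH⟩, hsD⟩
      have hsD' : ¬ s ≤ D := fun h => hsD ⟨hs, h⟩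
      have h3 : finrank K (s ⊓ D : Submodule K V) = 1 := by
        have e1 := Submodule.finrank_sup_add_finrank_inf_eq s D
        have e2 := Submodule.finrank_mono (sup_le hsH hDH)
        have e3 := Submodule.finrank_lt_finrank_of_lt
          ((inf_le_left : s ⊓ D ≤ s).lt_of_ne fun h => hsD' (inf_eq_left.1 h))
        have := hs.1
        omega
      have h4 := Submodule.ncard_mem_notMem (inf_le_left : s ⊓ D ≤ s)
      rw [h3, hs.1, pow_one] at h4
      rw [← h4]
      congr 1
      ext v
      constructor
      · exact fun hv => ⟨hv.2, fun h' => hv.1.2 ⟨h'.2, hv.1.1.2⟩⟩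
      · exact fun hv => ⟨⟨⟨hsH hv.1, hs.2.1 v hv.1⟩, fun h' => hv.2 ⟨hv.1, h'.1⟩⟩, hv.1⟩)
  have d1 := Set.ncard_sdiff_singleton_add_one
    (show (0 : V) ∈ {v | v ∈ H ∧ Q v = 0} from ⟨H.zero_mem, map_zero Q⟩)
  have d2 := Set.ncard_sdiff_add_ncard_of_subset
    (show {v | v ∈ D ∧ Q v = 0} ⊆ {v | v ∈ H ∧ Q v = 0} from fun v hv => ⟨hDH hv.1, hv.2⟩)
  have d3 := Set.ncard_sdiff_add_ncard_of_subset
    (show {s ∈ L | s ≤ D} ⊆ {s ∈ L | s ≤ H} from fun s hs => ⟨hs.1, hs.2.trans hDH⟩)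
  have e1 : 1 ≤ Nat.card K ^ 2 := Nat.one_le_pow _ _ (by omega)
  have e2 : Nat.card K ≤ Nat.card K ^ 2 := Nat.le_self_pow (by omega) _
  rw [mul_one] at c1 c2
  rw [c1] at d1
  rw [c2, hZD] at d2
  zify [e1, e2] at d1 d2 d3
  have := eq_add_one_of_line_counts (by exact_mod_cast hq) hε hZ (S := {s ∈ L | s ≤ H}.ncard)
    (A := {s ∈ L | s ≤ D}.ncard) (by linear_combination -d1)
    (by rw [← d3, add_sub_cancel_right]; linear_combination -d2)
  exact_mod_cast this

end NondegenerateLine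

/-! ### The dual cover of a vector product -/

section DualCover

open Module QuadraticMap

theorem two_ne_zero_of_odd_card {K : Type*} [Field K] (hodd : Odd (Nat.card K)) : (2 : K) ≠ 0 := by
  intro h2
  have h := card_nsmul_eq_zero' (x := (1 : K))
  obtain ⟨k, hk⟩ := hodd
  rw [hk, nsmul_eq_mul, mul_one] at h
  push_cast at h
  rw [h2] at h
  simp at h

variable {K V : Type*} [Field K] [Finite K] [AddCommGroup V] [Module K V] [FiniteDimensional K V]
variable {Q : QuadraticForm K V} {cr : V →ₗ[K] V →ₗ[K] V}

theorem IsVectorProduct.isDualCover (h : IsVectorProduct Q cr) (hQ : Q.polarBilin.Nondegenerate)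
    (hV : finrank K V = 7) (hodd : Odd (Nat.card K)) :
    IsDualCoverParabolicTypeI Q 6 (Nat.card K + 1) (vectorProductLines Q cr) := by
  have h2 := two_ne_zero_of_odd_card hodd
  have hq : 1 < Nat.card K := Finite.one_lt_card
  have hθ : projTheta (((6 : ℕ) : ℤ) - 5) (Nat.card K) = Nat.card K + 1 := by
    have : (((6 : ℕ) : ℤ) - 5 + 1).toNat = 2 := rfl
    rw [projTheta, this, Finset.sum_range_succ, Finset.sum_range_one, pow_zero, pow_one, add_comm]
  have hq' : (Nat.card K : ℚ) + 1 ≠ 0 := by positivity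
  refine ⟨⟨⟨inferInstance, hodd, by norm_num, by decide, hV, hQ⟩, fun l hl => hl.1,
    fun l hl => hl.2.1, fun P hP hPs => ?_⟩, fun l hl => ?_, fun l hl hlL hc => ?_⟩
  · obtain ⟨p, hp0, hp⟩ := finrank_eq_one_iff'.1 hP
    have hspan : P = Submodule.span K {(p : V)} := by
      refine le_antisymm (fun x hx => ?_) (by simp)
      obtain ⟨a, ha⟩ := hp ⟨x, hx⟩
      exact Submodule.mem_span_singleton.2 ⟨a, congrArg Subtype.val ha⟩
    rw [← h.ncard_lines_through hQ hV h2 (hPs p p.2) (by simpa using hp0)]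
    congr 1
    ext l
    exact and_congr_right fun _ =>
      ⟨fun h => h p.2, fun h => hspan.le.trans ((Submodule.span_singleton_le_iff_mem _ _).2 h)⟩
  · rw [h.ncard_lines_le_perp_of_mem hQ hV h2 hl, hθ]
    push_cast
    field_simp
    ring
  · have hc1 : (singularPointsIn Q l).ncard ≠ 1 := by
      intro h1
      rw [h1] at hc
      simp only [Set.mem_insert_iff, Set.mem_singleton_iff] at hc
      omega
    have hcard : {s ∈ vectorProductLines Q cr | s ≤ polarPerp Q l}.ncard = Nat.card K + 1 := by
      rcases isTotallySingular_or_disjoint_polarPerp h2 hl hc1 with hls | hdisj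
      · exact h.ncard_lines_le_perp_of_isTotallySingular hQ hV h2 hl hls hlL
      · exact h.ncard_lines_le_perp_of_disjoint hQ hV hodd h2 hl hdisj
    rw [hcard, hθ]
    push_cast
    field_simp

omit [Finite K] [FiniteDimensional K V] in
/-- The quadric and its polarity do not change when the form is multiplied by a scalar. -/
theorem IsDualCoverParabolicTypeI.smul {r m : ℕ} {L : Set (Submodule K V)}
    (h : IsDualCoverParabolicTypeI Q r m L) {c : K} (hc : c ≠ 0) :
    IsDualCoverParabolicTypeI (c • Q) r m L := by
  have hs : ∀ W, IsTotallySingular (c • Q) W ↔ IsTotallySingular Q W := by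
    intro W
    simp [IsTotallySingular, hc]
  have hp : ∀ W, polarPerp (c • Q) W = polarPerp Q W := by
    intro W
    ext x
    simp [mem_polarPerp, polar_smul, hc]
  have hpt : ∀ W, singularPointsIn (c • Q) W = singularPointsIn Q W := by
    intro W
    simp [singularPointsIn, hs]
  obtain ⟨⟨⟨h1, h2, h3, h4, h5, h6⟩, h7, h8, h9⟩, h10, h11⟩ := h
  refine ⟨⟨⟨h1, h2, h3, h4, h5, ?_, ?_⟩, h7, fun l hl => (hs l).2 (h8 l hl),
    fun P hP hPs => h9 P hP ((hs P).1 hPs)⟩, fun l hl => ?_, fun l hl hlL => ?_⟩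
  · intro x hx
    refine h6.1 x fun y => ?_
    simpa [polar_smul, hc] using hx y
  · intro x hx
    refine h6.2 x fun y => ?_
    simpa [polar_smul, hc] using hx y
  · rw [hp]
    exact h10 l hl
  · rw [hp, hpt]
    exact h11 l hl hlL

end DualCover

/-! ### The vector product in Tits' coordinates -/

section TitsCoordinates

open Module QuadraticMap

variable {K : Type*} [Field K]

/-- The commutator product of the trace zero split octonions, in Tits' coordinates.  Up to scalars,
six of its components are the linear equations between Grassmann coordinates that define the
hexagon lines. -/
def titsProduct (K : Type*) [Field K] : (Fin 7 → K) →ₗ[K] (Fin 7 → K) →ₗ[K] (Fin 7 → K) :=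
  LinearMap.mk₂ K (fun x y =>
    ![2 * (grassmannCoord x y 3 0 - grassmannCoord x y 6 5),
      2 * (grassmannCoord x y 3 1 - grassmannCoord x y 4 6),
      2 * (grassmannCoord x y 3 2 - grassmannCoord x y 5 4),
      -(grassmannCoord x y 0 4 + grassmannCoord x y 1 5 + grassmannCoord x y 2 6),
      2 * (grassmannCoord x y 1 2 - grassmannCoord x y 3 4),
      2 * (grassmannCoord x y 2 0 - grassmannCoord x y 3 5),
      2 * (grassmannCoord x y 0 1 - grassmannCoord x y 3 6)])
    (fun x x' y => by ext i; fin_cases i <;> simp [grassmannCoord] <;> ring)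
    (fun a x y => by ext i; fin_cases i <;> simp [grassmannCoord] <;> ring)
    (fun x y y' => by ext i; fin_cases i <;> simp [grassmannCoord] <;> ring)
    (fun a x y => by ext i; fin_cases i <;> simp [grassmannCoord] <;> ring)

theorem titsProduct_apply (x y : Fin 7 → K) :
    titsProduct K x y = ![2 * (grassmannCoord x y 3 0 - grassmannCoord x y 6 5),
      2 * (grassmannCoord x y 3 1 - grassmannCoord x y 4 6),
      2 * (grassmannCoord x y 3 2 - grassmannCoord x y 5 4),
      -(grassmannCoord x y 0 4 + grassmannCoord x y 1 5 + grassmannCoord x y 2 6),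
      2 * (grassmannCoord x y 1 2 - grassmannCoord x y 3 4),
      2 * (grassmannCoord x y 2 0 - grassmannCoord x y 3 5),
      2 * (grassmannCoord x y 0 1 - grassmannCoord x y 3 6)] := rfl

theorem polar_titsForm (x y : Fin 7 → K) : polar (titsForm K) x y
    = x 0 * y 4 + x 4 * y 0 + x 1 * y 5 + x 5 * y 1 + x 2 * y 6 + x 6 * y 2 - 2 * x 3 * y 3 := by
  simp only [polar, titsForm_apply, Pi.add_apply]
  ring

theorem isVectorProduct_titsProduct : IsVectorProduct (titsForm K) (titsProduct K) where
  cr_self x := by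
    ext i
    fin_cases i <;> simp [titsProduct_apply, grassmannCoord, mul_comm]
  cr_cr x y := by
    ext i
    fin_cases i <;>
      simp [titsProduct_apply, grassmannCoord, polar_titsForm, titsForm_apply] <;> ring
  map_cr x y := by
    simp [titsProduct_apply, grassmannCoord, polar_titsForm, titsForm_apply]
    ring
  polar_cr x y z := by
    simp [titsProduct_apply, grassmannCoord, polar_titsForm]
    ring

theorem polarBilin_titsForm_nondegenerate (h2 : (2 : K) ≠ 0) :
    (titsForm K).polarBilin.Nondegenerate := by
  have hleft : (titsForm K).polarBilin.SeparatingLeft := by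
    intro x hx
    have h : ∀ i, polar (titsForm K) x (Pi.single i 1) = 0 := fun i => hx _
    simp only [polar_titsForm] at h
    have h0 := h 0
    have h1 := h 1
    have h3 := h 2
    have h4 := h 3
    have h5 := h 4
    have h6 := h 5
    have h7 := h 6
    simp [h2] at h0 h1 h3 h4 h5 h6 h7
    ext i
    fin_cases i <;> simp [*]
  refine ⟨hleft, fun x hx => hleft x fun y => ?_⟩
  have := hx y
  rw [polarBilin_apply_apply] at this ⊢
  rw [polar_comm, this]

/-- The remaining component of the vector product vanishes on a totally singular line as soon as
the other six do, since the product of two vectors of the line is singular. -/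
theorem splitCayleyHexagonLines_eq (h2 : (2 : K) ≠ 0) :
    splitCayleyHexagonLines K = vectorProductLines (titsForm K) (titsProduct K) := by
  ext l
  refine and_congr_right fun _ => and_congr_right fun hls => ?_
  refine forall₂_congr fun x hx => forall₂_congr fun y hy => ?_
  constructor
  · rintro ⟨h1, h3, h4, h5, h6, h7⟩
    have hc : titsProduct K x y = ![0, 0, 0, titsProduct K x y 3, 0, 0, 0] := by
      rw [titsProduct_apply, h1, h3, h4, h5, h6, h7]
      simp
    have hQ := isVectorProduct_titsProduct.map_cr x y
    rw [hls x hx, hls y hy, hls.polar_eq_zero hx hy, hc, titsForm_apply] at hQ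
    have h0 : titsProduct K x y 3 = 0 := by simpa using hQ
    rw [hc, h0]
    ext i
    fin_cases i <;> rfl
  · intro h
    rw [titsProduct_apply] at h
    have h' := fun i => congrFun h i
    have e0 := h' 0
    have e1 := h' 1
    have e3 := h' 2
    have e4 := h' 4
    have e5 := h' 5
    have e6 := h' 6
    simp [h2, sub_eq_zero] at e0 e1 e3 e4 e5 e6
    exact ⟨e4, e3.symm, e5, e0.symm, e6, e1.symm⟩

end TitsCoordinates

/-! ### Change of coordinates -/

section Transport

open Module QuadraticMap

variable {K V : Type*} [Field K] [AddCommGroup V] [Module K V]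

/-- The transport of a bilinear product along a linear equivalence. -/
def transportProduct {W : Type*} [AddCommGroup W] [Module K W] (e : V ≃ₗ[K] W)
    (cr : W →ₗ[K] W →ₗ[K] W) : V →ₗ[K] V →ₗ[K] V :=
  (cr.compl₁₂ (e : V →ₗ[K] W) (e : V →ₗ[K] W)).compr₂ (e.symm : W →ₗ[K] V)

variable {W : Type*} [AddCommGroup W] [Module K W]

theorem transportProduct_apply (e : V ≃ₗ[K] W) (cr : W →ₗ[K] W →ₗ[K] W) (x y : V) :
    transportProduct e cr x y = e.symm (cr (e x) (e y)) := rfl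

theorem polar_comp_linearEquiv (e : V ≃ₗ[K] W) (Q : QuadraticForm K W) (x y : V) :
    polar (Q.comp (e : V →ₗ[K] W)) x y = polar Q (e x) (e y) := by
  simp [polar]

theorem IsVectorProduct.transport {Q : QuadraticForm K W} {cr : W →ₗ[K] W →ₗ[K] W}
    (h : IsVectorProduct Q cr) (e : V ≃ₗ[K] W) :
    IsVectorProduct (Q.comp (e : V →ₗ[K] W)) (transportProduct e cr) where
  cr_self x := by simp [transportProduct_apply, h.cr_self]
  cr_cr x y := by
    apply e.injective
    simp [transportProduct_apply, polar_comp_linearEquiv, h.cr_cr]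
  map_cr x y := by simp [transportProduct_apply, polar_comp_linearEquiv, h.map_cr]
  polar_cr x y z := by simp [transportProduct_apply, polar_comp_linearEquiv, h.polar_cr]

theorem map_mem_vectorProductLines {Q : QuadraticForm K W} {cr : W →ₗ[K] W →ₗ[K] W}
    (e : V ≃ₗ[K] W) (l : Submodule K V) :
    l.map (e : V →ₗ[K] W) ∈ vectorProductLines Q cr ↔
      l ∈ vectorProductLines (Q.comp (e : V →ₗ[K] W)) (transportProduct e cr) := by
  have hfr : Module.finrank K (l.map (e : V →ₗ[K] W)) = Module.finrank K l :=
    LinearEquiv.finrank_map_eq e l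
  simp only [vectorProductLines, Set.mem_ofPred_eq, IsTotallySingular, hfr, Submodule.mem_map,
    forall_exists_index, and_imp, forall_apply_eq_imp_iff₂, transportProduct_apply,
    LinearEquiv.map_eq_zero_iff, LinearEquiv.coe_coe, QuadraticMap.comp_apply]

theorem polarBilin_comp_linearEquiv_nondegenerate {Q : QuadraticForm K W}
    (hQ : Q.polarBilin.Nondegenerate) (e : V ≃ₗ[K] W) :
    (Q.comp (e : V →ₗ[K] W)).polarBilin.Nondegenerate := by
  refine ⟨fun x hx => ?_, fun x hx => ?_⟩
  · refine e.map_eq_zero_iff.1 (hQ.1 (e x) fun y => ?_)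
    simpa [polar_comp_linearEquiv] using hx (e.symm y)
  · refine e.map_eq_zero_iff.1 (hQ.2 (e x) fun y => ?_)
    simpa [polar_comp_linearEquiv] using hx (e.symm y)

end Transport

/-! ### The split Cayley hexagon -/

theorem mainTheorem12 {K V : Type*} [Field K] [Finite K] [AddCommGroup V] [Module K V]
    (hodd : Odd (Nat.card K)) (Q : QuadraticForm K V) (L : Set (Submodule K V))
    (hL : IsSplitCayleyHexagonIn Q L) :
    IsDualCoverParabolicTypeI Q 6 (Nat.card K + 1) L := by
  obtain ⟨e, c, hc, hQ, hL⟩ := hL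
  have h2 := two_ne_zero_of_odd_card hodd
  have : FiniteDimensional K V := Module.Finite.equiv e.symm
  have hV : Module.finrank K V = 7 := by rw [e.finrank_eq, Module.finrank_fin_fun]
  obtain rfl : Q = c • (titsForm K).comp (e : V →ₗ[K] (Fin 7 → K)) := by
    ext v
    simp [hQ]
  obtain rfl : L = vectorProductLines ((titsForm K).comp (e : V →ₗ[K] (Fin 7 → K)))
      (transportProduct e (titsProduct K)) := by
    ext l
    rw [hL, splitCayleyHexagonLines_eq h2, map_mem_vectorProductLines]
  exact ((isVectorProduct_titsProduct.transport e).isDualCover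
    (polarBilin_comp_linearEquiv_nondegenerate (polarBilin_titsForm_nondegenerate h2) e)
    hV hodd).smul hc
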